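/- Conventions. An ideal $I$ of a domain $A$ with fraction field $K(A)$ is *central* if, for all $a\in A$ and all sums of squares $b\in\sum K(A)^2$, $a^2+b\in I$ implies $a\in I$. An extension (injective homomorphism) $A\to C$ of domains is *centrally subintegral* if it is integral, the contraction map from the central prime ideals of $C$ to the central prime ideals of $A$ is well defined and bijective, and for every central prime $\mathfrak q$ of $C$ the residue field extension $k(\mathfrak q\cap A)\to k(\mathfrak q)$ is an isomorphism. For an extension $A\to B$ of domains, the *central seminormalization* $A^{s_c,*}_B$ of $A$ in $B$ is the greatest element (for inclusion; in particular the unique maximal element) among the rings $C$ with $A\subseteq C\subseteq B$ such that $A\to C$ is centrally subintegral. An irreducible affine algebraic variety $X$ over $\mathbb R$ is the spectrum of a domain $\mathbb R[X]$ that is a finitely generated $\mathbb R$-algebra; morphisms are morphisms over $\mathbb R$. Given a dominant morphism $Y\to X$ of such varieties, an *intermediate variety* is an irreducible affine algebraic variety $V$ over $\mathbb R$ with a factorization $Y\to V\to X$ in which $Y\to V$ is dominant; it is *centrally subintegral over $X$* if $\mathbb R[X]\to\mathbb R[V]$ is centrally subintegral. For intermediate varieties $V,W$ write $V\le W$ if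 $W\to X$ factorizes through $V\to X$ compatibly with the morphisms from $Y$. A *central seminormalization* $X^{s_c,*}_Y$ of $X$ in $Y$ is a maximal element among the intermediate varieties that are centrally subintegral over $X$, unique up to isomorphism compatible with the morphisms from $Y$ and to $X$. **Theorem.** Let $Y\to X$ be a dominant morphism of finite type (i.e. $\mathbb R[Y]$ is a finitely generated $\mathbb R[X]$-algebra) between irreducible affine algebraic varieties over $\mathbb R$. Then the central seminormalization $X^{s_c,*}_Y$ of $X$ in $Y$ exists; moreover an intermediate variety $V$ is centrally subintegral over $X$ if and only if $V\le X^{s_c,*}_Y$. The central seminormalization $\mathbb R[X]^{s_c,*}_{\mathbb R[Y]}$ of $\mathbb R[X]$ in $\mathbb R[Y]$ exists, and it is the coordinate ring of $X^{s_c,*}_Y$: the homomorphism $\mathbb R[X^{s_c,*}_Y]\to\mathbb R[Y]$ is injective with image $$\mathbb R[X^{s_c,*}_Y]=\mathbb R[X]^{s_c,*}_{\mathbb R[Y]}.$$ In particular $\mathbb R[X]^{s_c,*}_{\mathbb R[Y]}$ is a finitely generated $\mathbb R$-algebra. -/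

import Mathlib

open CategoryTheory AlgebraicGeometry

/-! ### Central algebra -/

/-- An ideal `I` of a domain `A` is central if for all `a ∈ A` and all sums of squares `b` of
elements of the fraction field of `A`: if `a² + b` lies in `I`, then `a ∈ I`. -/
def IsCentralIdeal {A : Type*} [CommRing A] (I : Ideal A) : Prop :=
  ∀ (a : A) (b : FractionRing A), IsSumSq b →
    (∃ c ∈ I, algebraMap A (FractionRing A) c = algebraMap A (FractionRing A) a ^ 2 + b) → a ∈ I

/-- The set of central prime ideals of a domain `A`. -/
def centralSpectrum (A : Type*) [CommRing A] : Set (PrimeSpectrum A) :=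
  {p | IsCentralIdeal p.asIdeal}

/-- A ring homomorphism of domains `φ : A → B` is a centrally subintegral extension if it is an
injective integral homomorphism, contraction induces a bijection from the central spectrum of `B`
onto that of `A`, and for every central prime `q` of `B` the residue field extension
`k(q ∩ A) → k(q)` is an isomorphism. -/
structure IsCentrallySubintegral {A B : Type*} [CommRing A] [CommRing B] (φ : A →+* B) :
    Prop where
  injective : Function.Injective φ
  integral : φ.IsIntegral
  bijOn : Set.BijOn (PrimeSpectrum.comap φ) (centralSpectrum B) (centralSpectrum A)
  equiresidual : ∀ q ∈ centralSpectrum B, Function.Bijective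
    (Ideal.ResidueField.map (q.asIdeal.comap φ) q.asIdeal φ rfl)

/-- The intermediate rings `C` of an extension of domains `φ : A → B` (viewed as the subrings of
`B` that contain the image of `A`) such that `A → C` is centrally subintegral. -/
def centrallySubintegralSubrings {A B : Type*} [CommRing A] [CommRing B] (φ : A →+* B) :
    Set (Subring B) :=
  {C | ∃ h : ∀ a, φ a ∈ C, IsCentrallySubintegral (φ.codRestrict C h)}

/-- `C` is the central seminormalization of `A` in `B`: the greatest (so also the unique maximal)
element among the intermediate rings which are centrally subintegral over `A`. -/
def IsCentralSeminormalizationRing {A B : Type*} [CommRing A] [CommRing B] (φ : A →+* B)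
    (C : Subring B) : Prop :=
  IsGreatest (centrallySubintegralSubrings φ) C

/-! ### Irreducible affine algebraic varieties over `ℝ` -/

/-- An `ℝ`-scheme is an irreducible affine algebraic variety over `ℝ` if it is affine, integral
and of finite type over `ℝ`, that is, if it is the spectrum of a domain which is a finitely
generated `ℝ`-algebra. -/
structure IsIrreducibleAffineRealVariety (X : Over (Spec (CommRingCat.of ℝ))) : Prop where
  isAffine : IsAffine X.left
  isIntegral : IsIntegral X.left
  locallyOfFiniteType : LocallyOfFiniteType X.hom

/-- The coordinate ring `ℝ[X]`. -/
noncomputable abbrev coordinateRing (X : Over (Spec (CommRingCat.of ℝ))) : CommRingCat := Γ(X.left, ⊤)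

/-- The ring homomorphism `ℝ → ℝ[X]` that makes `ℝ[X]` an `ℝ`-algebra. -/
noncomputable def realStructure (X : Over (Spec (CommRingCat.of ℝ))) : ℝ →+* coordinateRing X :=
  ((Scheme.ΓSpecIso (CommRingCat.of ℝ)).inv ≫ X.hom.appTop).hom

/-- The ring homomorphism `f^* : ℝ[X] → ℝ[Y]` associated with a morphism `f : Y → X`. -/
noncomputable def coordinateMap {X Y : Over (Spec (CommRingCat.of ℝ))} (f : Y ⟶ X) :
    coordinateRing X →+* coordinateRing Y :=
  f.left.appTop.hom

/-- An irreducible affine variety `V` intermediate between `X` and `Y`: a factorization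
`Y → V → X` of `f : Y → X` with `Y → V` dominant. If `f` is a dominant morphism of irreducible
affine varieties, then `V → X` is dominant as well, so `ℝ[X] → ℝ[V] → ℝ[Y]` are extensions. -/
structure IntermediateVariety {X Y : Over (Spec (CommRingCat.of ℝ))} (f : Y ⟶ X) where
  V : Over (Spec (CommRingCat.of ℝ))
  isVariety : IsIrreducibleAffineRealVariety V
  fromY : Y ⟶ V
  toX : V ⟶ X
  fac : fromY ≫ toX = f
  dominant : IsDominant fromY.left

namespace IntermediateVariety

variable {X Y : Over (Spec (CommRingCat.of ℝ))} {f : Y ⟶ X}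

/-- `V ≤ W` if `W → X` factorizes through `V → X`, compatibly with the morphisms from `Y`. -/
instance : LE (IntermediateVariety f) where
  le V W := ∃ t : W.V ⟶ V.V, W.fromY ≫ t = V.fromY ∧ t ≫ V.toX = W.toX

/-- The morphism `V → X` is centrally subintegral. -/
def CentrallySubintegral (V : IntermediateVariety f) : Prop :=
  IsCentrallySubintegral (coordinateMap V.toX)

/-- `Z` is a central seminormalization of `X` in `Y`: `Z` is maximal among the intermediate
varieties that are centrally subintegral over `X`, and every maximal one is isomorphic to `Z` by
an isomorphism compatible with the morphisms from `Y` and to `X`. -/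
def IsCentralSeminormalization (Z : IntermediateVariety f) : Prop :=
  Maximal CentrallySubintegral Z ∧
    ∀ W : IntermediateVariety f, Maximal CentrallySubintegral W →
      ∃ e : W.V ≅ Z.V, W.fromY ≫ e.hom = Z.fromY ∧ e.hom ≫ Z.toX = W.toX

end IntermediateVariety

/-!
Centrally subintegral extensions are controlled by congruences. Let `A → B` be an extension of
domains.

If `K(A)` is not formally real, `-1` is a sum of squares in the fraction field of every extension
of `A`, so there are no central primes at all and an extension is centrally subintegral exactly
when it is integral: the central seminormalization is the integral closure of `A` in `B`.

If `K(A)` is formally real, the zero ideal is central, so a centrally subintegral extension is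
birational, and everything takes place inside the ring `E` of the elements of `B` that are integral
over `A` and lie in `K(A)` (`birationalClosure`). The central seminormalization is then obtained by
gluing: it consists of the `b ∈ E` such that for each central prime `p` of `A` some fraction
`a / s` with `s ∉ p` is congruent to `b` at all central primes of `E` over `p` (`centralGluing`).
An intermediate ring `C` is centrally subintegral if and only if it is contained in this ring
(`exists_subring_isCentrallySubintegral_iff_le`). The essential input is lying over for central
primes in integral birational extensions (`exists_central_prime_comap_eq`), which gives
central primes of `E` over those of `C`. It rests on the estimate `exists_mem_isSumSq_sub_pow`: an
element integral over an ideal `I` has an even power bounded, modulo sums of squares, by an element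
of `I`, as one sees from Lagrange's bound for the roots of a polynomial.

In the geometric case the ring so obtained is integral over `ℝ[X]`, and it is finitely generated
because it embeds, by Noether normalization and the Nullstellensatz, into the integral closure of a
polynomial ring in a finite extension of its fraction field
(`Module.Finite.of_isIntegral_of_finiteType_extension`). It is thus the coordinate ring of a
variety, and the order between intermediate varieties is the inclusion of their coordinate rings in
`ℝ[Y]` (`IntermediateVariety.le_iff_range_le`).
-/

/-! ### Inequalities for the preorder of sums of squares -/

section SumsOfSquares

variable {K : Type*} [Field K]

theorem IsSumSq.of_eq {R : Type*} [CommRing R] {a b : R} (ha : IsSumSq a) (h : a = b) :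
    IsSumSq b := h ▸ ha

theorem IsSumSq.map {R S F : Type*} [CommRing R] [CommRing S] [FunLike F R S]
    [RingHomClass F R S] {a : R} (ha : IsSumSq a) (f : F) : IsSumSq (f a) := by
  induction ha with
  | zero => simp
  | sq_add a hs ih => rw [map_add, map_mul]; exact (IsSumSq.mul_self _).add ih

theorem IsSumSq.pow {R : Type*} [CommRing R] {a : R} (ha : IsSumSq a) (n : ℕ) :
    IsSumSq (a ^ n) := by
  induction n with
  | zero => simp
  | succ n ih => rw [pow_succ]; exact ih.mul ha

theorem IsSumSq.sq {R : Type*} [CommRing R] (a : R) : IsSumSq (a ^ 2) := by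
  rw [pow_two]; exact IsSumSq.mul_self a

theorem IsSumSq.pow_sub_pow {R : Type*} [CommRing R] {a b : R} (ha : IsSumSq a)
    (hab : IsSumSq (b - a)) (n : ℕ) : IsSumSq (b ^ n - a ^ n) := by
  have hb : IsSumSq b := by simpa using hab.add ha
  induction n with
  | zero => simp
  | succ n ih =>
    have h := (ih.mul hb).add ((ha.pow n).mul hab)
    exact h.of_eq (by ring)

/-- The Lagrange root bound: if `y ^ n ≤ q (1 + y + ⋯ + y ^ (n - 1))`, then `y ≤ 1 + q`. -/
theorem isSumSq_one_add_sub_of_geom_sum (hK : ¬ IsSumSq (-1 : K)) {y q : K} (hy : IsSumSq y)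
    {n : ℕ} (h : IsSumSq (q * ∑ i ∈ Finset.range n, y ^ i - y ^ n)) :
    IsSumSq (1 + q - y) := by
  set S := ∑ i ∈ Finset.range n, y ^ i with hS
  have hSs : IsSumSq S := IsSumSq.sum fun i _ => hy.pow i
  have hS0 : S ≠ 0 := by
    intro h0
    apply hK
    cases n with
    | zero =>
      rw [h0] at h
      simpa using h
    | succ n =>
      rw [Finset.sum_range_succ'] at hS
      have e : (-1 : K) = ∑ i ∈ Finset.range n, y ^ (i + 1) := by
        rw [h0, pow_zero] at hS; linear_combination hS
      rw [e]
      exact IsSumSq.sum fun i _ => hy.pow _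
  have hg : S * (y - 1) = y ^ n - 1 := geom_sum_mul y n
  -- `(1 + q - y) S = q S - y ^ n + 1`, and the inverse of a nonzero sum of squares is one as well.
  have h1 : IsSumSq ((1 + q - y) * S) := by
    exact (h.add IsSumSq.one).of_eq (by linear_combination hg)
  have h2 := (h1.mul hSs).mul (IsSumSq.sq S⁻¹)
  exact h2.of_eq (by field_simp)

/-- The Cauchy–Schwarz inequality for sums of squares. The factor `2` avoids a division. -/
theorem isSumSq_card_mul_sum_sq_sub {R ι : Type*} [CommRing R] (s : Finset ι) (u : ι → R) :
    IsSumSq (2 * (s.card : R) * ∑ i ∈ s, u i ^ 2 - (∑ i ∈ s, u i) ^ 2) := by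
  have h : 2 * (s.card : R) * ∑ i ∈ s, u i ^ 2 - (∑ i ∈ s, u i) ^ 2
      = (∑ i ∈ s, ∑ j ∈ s, (u i - u j) ^ 2) + (∑ i ∈ s, u i) ^ 2 := by
    have e : ∑ i ∈ s, ∑ j ∈ s, (u i - u j) ^ 2
        = 2 * (s.card : R) * ∑ i ∈ s, u i ^ 2 - 2 * (∑ i ∈ s, u i) * (∑ i ∈ s, u i) := by
      simp only [sub_sq, Finset.sum_add_distrib, Finset.sum_sub_distrib, Finset.sum_const,
        nsmul_eq_mul, ← Finset.mul_sum, ← Finset.sum_mul]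
      ring
    rw [e]; ring
  rw [h]
  exact (IsSumSq.sum fun i _ => IsSumSq.sum fun j _ => IsSumSq.sq _).add (IsSumSq.sq _)

end SumsOfSquares

/-- If `x` is integral over the ideal `I`, then some even power of `x` is bounded above, for the
preorder of sums of squares, by an element of `I`. -/
theorem exists_mem_isSumSq_sub_pow {A K : Type*} [CommRing A] [Field K] [Algebra A K]
    (hK : ¬ IsSumSq (-1 : K)) (I : Ideal A) (x : K) (P : Polynomial A) (hP : P.Monic)
    (hPx : Polynomial.aeval x P = 0) (hPI : ∀ i ≠ P.natDegree, P.coeff i ∈ I) :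
    ∃ n, ∃ e ∈ I, IsSumSq (algebraMap A K e - x ^ (2 * n)) := by
  set n := P.natDegree with hn
  set y := x ^ 2 with hy
  have hys : IsSumSq y := IsSumSq.sq x
  have hx : x ^ n = -∑ i ∈ Finset.range n, algebraMap A K (P.coeff i) * x ^ i := by
    rw [Polynomial.aeval_eq_sum_range, Finset.sum_range_succ, ← hn, hn, hP.coeff_natDegree,
      one_smul, ← hn] at hPx
    simp only [Algebra.smul_def] at hPx
    linear_combination hPx
  set q : A := 2 * n * ∑ i ∈ Finset.range n, P.coeff i ^ 2 with hq
  have hqI : q ∈ I := I.mul_mem_left _ <| I.sum_mem fun i hi =>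
    I.pow_mem_of_mem (hPI i (Finset.mem_range.mp hi).ne) 2 (by norm_num)
  have hqs : IsSumSq (algebraMap A K q) := by
    have : IsSumSq (algebraMap A K (2 * n * ∑ i ∈ Finset.range n, P.coeff i ^ 2)) := by
      apply IsSumSq.map
      refine IsSumSq.mul ?_ (IsSumSq.sum fun i _ => IsSumSq.sq _)
      exact_mod_cast IsSumSq.natCast (R := A) (2 * n)
    exact this
  -- Cauchy–Schwarz, followed by `p_i ^ 2 ≤ ∑ j, p_j ^ 2`; squaring makes the coefficients and `y`
  -- nonnegative, so that no absolute values are needed.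
  have h1 : IsSumSq (algebraMap A K q * ∑ i ∈ Finset.range n, y ^ i - y ^ n) := by
    have hcs := isSumSq_card_mul_sum_sq_sub (Finset.range n)
      fun i => algebraMap A K (P.coeff i) * x ^ i
    have hyn : y ^ n = (∑ i ∈ Finset.range n, algebraMap A K (P.coeff i) * x ^ i) ^ 2 := by
      rw [hy, ← pow_mul, mul_comm, pow_mul, hx, neg_sq]
    rw [Finset.card_range, ← hyn] at hcs
    have hd : IsSumSq (2 * (n : K) * ∑ i ∈ Finset.range n,
        (∑ j ∈ (Finset.range n).erase i, algebraMap A K (P.coeff j) ^ 2) * y ^ i) := by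
      refine IsSumSq.mul ?_ (IsSumSq.sum fun i _ =>
        (IsSumSq.sum fun j _ => IsSumSq.sq _).mul (hys.pow i))
      exact_mod_cast IsSumSq.natCast (R := K) (2 * n)
    have hsum := hcs.add hd
    refine hsum.of_eq ?_
    have e : ∑ i ∈ Finset.range n, (algebraMap A K (P.coeff i) * x ^ i) ^ 2
        + ∑ i ∈ Finset.range n,
          (∑ j ∈ (Finset.range n).erase i, algebraMap A K (P.coeff j) ^ 2) * y ^ i
        = (∑ j ∈ Finset.range n, algebraMap A K (P.coeff j) ^ 2) *
          ∑ i ∈ Finset.range n, y ^ i := by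
      rw [← Finset.sum_add_distrib, Finset.mul_sum]
      refine Finset.sum_congr rfl fun i hi => ?_
      rw [← Finset.add_sum_erase _ _ hi, hy]
      ring
    have eq : algebraMap A K q
        = 2 * (n : K) * ∑ j ∈ Finset.range n, algebraMap A K (P.coeff j) ^ 2 := by
      simp only [hq, map_mul, map_sum, map_pow, map_ofNat, map_natCast]
    rw [eq]
    linear_combination (2 * (n : K)) * e
  have h2 := isSumSq_one_add_sub_of_geom_sum hK hys h1
  refine ⟨n, q * ∑ i ∈ Finset.range n, (1 + q) ^ i, I.mul_mem_right _ hqI, ?_⟩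
  have h3 : IsSumSq (algebraMap A K q *
      ∑ i ∈ Finset.range n, ((1 + algebraMap A K q) ^ i - y ^ i)) :=
    hqs.mul (IsSumSq.sum fun i _ => hys.pow_sub_pow h2 i)
  have h4 := h3.add h1
  refine h4.of_eq ?_
  rw [Finset.sum_sub_distrib, hy, ← pow_mul]
  simp only [map_mul, map_sum, map_pow, map_add, map_one]
  ring

/-! ### Central ideals -/

section Central

variable {A : Type*} [CommRing A]

/-- Centrality can be tested in any model `K` of the fraction field. -/
theorem isCentralIdeal_iff (K : Type*) [Field K] [Algebra A K] [IsFractionRing A K]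
    {I : Ideal A} : IsCentralIdeal I ↔ ∀ a, ∀ c ∈ I,
      IsSumSq (algebraMap A K c - algebraMap A K a ^ 2) → a ∈ I := by
  let e := FractionRing.algEquiv A K
  constructor
  · intro h a c hc hs
    refine h a (e.symm (algebraMap A K c - algebraMap A K a ^ 2)) (hs.map e.symm) ⟨c, hc, ?_⟩
    simp
  · rintro h a b hb ⟨c, hc, hcb⟩
    refine h a c hc ?_
    have := congrArg e hcb
    simp only [map_add, map_pow, AlgEquiv.commutes] at this
    rw [this, add_sub_cancel_left]
    exact hb.map e

theorem IsCentralIdeal.comap [IsDomain A] {B : Type*} [CommRing B] [IsDomain B] {φ : A →+* B}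
    (hφ : Function.Injective φ) {J : Ideal B} (hJ : IsCentralIdeal J) :
    IsCentralIdeal (J.comap φ) := by
  rw [isCentralIdeal_iff (FractionRing B)] at hJ
  rw [isCentralIdeal_iff (FractionRing A)]
  intro a c hc hs
  refine hJ (φ a) (φ c) hc ?_
  have := hs.map (IsFractionRing.map (K := FractionRing A) (L := FractionRing B) hφ)
  simpa [IsFractionRing.map, IsLocalization.map_eq] using this

/-- Central primes can only exist when `-1` is not a sum of squares in the fraction field. -/
theorem IsCentralIdeal.not_isSumSq_neg_one {I : Ideal A} (hI : IsCentralIdeal I) (hI' : I ≠ ⊤)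
    (K : Type*) [Field K] [Algebra A K] [IsFractionRing A K] : ¬ IsSumSq (-1 : K) := by
  intro h
  rw [isCentralIdeal_iff K] at hI
  exact hI' ((Ideal.eq_top_iff_one _).mpr (hI 1 0 I.zero_mem (by simpa using h)))

theorem isSumSq_neg_one_of_not_isCentralIdeal_bot [IsDomain A] (K : Type*) [Field K] [Algebra A K]
    [IsFractionRing A K] (h : ¬ IsCentralIdeal (⊥ : Ideal A)) : IsSumSq (-1 : K) := by
  rw [isCentralIdeal_iff K] at h
  push Not at h
  obtain ⟨a, c, hc, hs, ha⟩ := h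
  rw [Ideal.mem_bot] at hc ha
  subst hc
  have ha' : algebraMap A K a ≠ 0 := by simpa using ha
  have := hs.mul (IsSumSq.sq (algebraMap A K a)⁻¹)
  refine this.of_eq ?_
  rw [map_zero, zero_sub, neg_mul, ← mul_pow, mul_inv_cancel₀ ha', one_pow]

/-- An extension `A → C` of domains is birational if every element of `C` is a fraction of
elements of `A`. -/
def IsBirationalExtension (A C : Type*) [CommRing A] [CommRing C] [Algebra A C] : Prop :=
  ∀ c : C, ∃ s : A, s ≠ 0 ∧ ∃ a : A, algebraMap A C s * c = algebraMap A C a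

theorem IsBirationalExtension.isFractionRing {C : Type*} [CommRing C] [IsDomain C] [Algebra A C]
    (hinj : Function.Injective (algebraMap A C)) (h : IsBirationalExtension A C)
    (K : Type*) [Field K] [Algebra C K] [IsFractionRing C K] [Algebra A K] [IsScalarTower A C K] :
    IsFractionRing A K := by
  have hAK : Function.Injective (algebraMap A K) := by
    rw [IsScalarTower.algebraMap_eq A C K]
    exact (IsFractionRing.injective C K).comp hinj
  have : FaithfulSMul A K := (faithfulSMul_iff_algebraMap_injective A K).mpr hAK
  refine IsFractionRing.of_field A K fun z => ?_
  obtain ⟨c, d, hd, rfl⟩ := IsFractionRing.div_surjective C z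
  obtain ⟨s, hs, a, hsa⟩ := h c
  obtain ⟨t, ht, b, htb⟩ := h d
  have hs' : algebraMap A K s ≠ 0 := fun h0 => hs (hAK (by simpa using h0))
  have ht' : algebraMap A K t ≠ 0 := fun h0 => ht (hAK (by simpa using h0))
  have hd' : algebraMap C K d ≠ 0 := by simpa using nonZeroDivisors.ne_zero hd
  have h1 : algebraMap A K s * algebraMap C K c = algebraMap A K a := by
    simpa [IsScalarTower.algebraMap_apply A C K] using congrArg (algebraMap C K) hsa
  have h2 : algebraMap A K t * algebraMap C K d = algebraMap A K b := by
    simpa [IsScalarTower.algebraMap_apply A C K] using congrArg (algebraMap C K) htb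
  refine ⟨a * t, b * s, ?_⟩
  rw [map_mul, map_mul, ← h1, ← h2]
  field_simp

/-- Lying over for central primes in integral birational extensions. The prime is obtained as an
ideal containing `pC` and maximal among those disjoint from the multiplicative set of the elements
`a ^ 2 + b`, where `a ∈ A ∖ p` and `b` is a sum of squares in the fraction field. -/
theorem exists_central_prime_comap_eq [IsDomain A] {C : Type*} [CommRing C] [IsDomain C]
    [Algebra A C] [Algebra.IsIntegral A C] (hinj : Function.Injective (algebraMap A C))
    (hbir : IsBirationalExtension A C) (p : Ideal A) [p.IsPrime] (hp : IsCentralIdeal p) :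
    ∃ q : Ideal C, q.IsPrime ∧ IsCentralIdeal q ∧ q.comap (algebraMap A C) = p := by
  let K := FractionRing C
  have : IsFractionRing A K := hbir.isFractionRing hinj K
  have hK := hp.not_isSumSq_neg_one (Ideal.IsPrime.ne_top ‹_›) K
  let M : Submonoid C :=
    { carrier := {m | ∃ a ∉ p, IsSumSq (algebraMap C K m - algebraMap C K (algebraMap A C a) ^ 2)}
      one_mem' := ⟨1, (Ideal.ne_top_iff_one p).mp (Ideal.IsPrime.ne_top ‹_›), by simp⟩
      mul_mem' := by
        rintro m m' ⟨a, ha, h⟩ ⟨a', ha', h'⟩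
        refine ⟨a * a', fun h0 => (Ideal.IsPrime.mem_or_mem ‹_› h0).elim ha ha', ?_⟩
        have := ((IsSumSq.sq (algebraMap C K (algebraMap A C a))).mul h').add
          ((h.mul (IsSumSq.sq (algebraMap C K (algebraMap A C a')))).add (h.mul h'))
        refine this.of_eq ?_
        simp only [map_mul]
        ring }
  have hdisj : Disjoint (p.map (algebraMap A C) : Set C) M := by
    rw [Set.disjoint_left]
    rintro x hx ⟨a, ha, hs⟩
    obtain ⟨P, hP, hPx, hPI⟩ := Polynomial.exists_monic_aeval_eq_zero_forall_mem_of_mem_map hx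
    have hPx' : Polynomial.aeval (algebraMap C K x) P = 0 := by
      rw [Polynomial.aeval_algebraMap_apply, hPx, map_zero]
    obtain ⟨n, e, he, hes⟩ := exists_mem_isSumSq_sub_pow hK p _ P hP hPx' hPI
    have h1 := (IsSumSq.sq (algebraMap C K (algebraMap A C a))).pow_sub_pow hs (2 * n)
    refine ha (Ideal.IsPrime.mem_of_pow_mem ‹_› (2 * n)
      ((isCentralIdeal_iff K).mp hp (a ^ (2 * n)) e he ?_))
    refine (hes.add h1).of_eq ?_
    simp only [map_pow, IsScalarTower.algebraMap_apply A C K]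
    ring
  obtain ⟨q, hpq, hq⟩ := zorn_le_nonempty₀ {J : Ideal C | Disjoint (J : Set C) M}
    (fun c hc hcc y hy => ⟨sSup c, by
      change Disjoint _ _
      rw [Set.disjoint_left]
      intro x hx
      obtain ⟨J, hJ, hxJ⟩ := (Submodule.mem_sSup_of_directed ⟨y, hy⟩ hcc.directedOn).mp hx
      exact Set.disjoint_left.mp (hc hJ) hxJ, fun _ => le_sSup⟩) _ hdisj
  have hqd : Disjoint (q : Set C) M := hq.prop
  have hqm : ∀ J : Ideal C, q < J → ¬ Disjoint (J : Set C) M := fun J hJ => hq.not_prop_of_gt hJ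
  have hqp : q.IsPrime := Ideal.isPrime_of_maximally_disjoint q M hqd hqm
  refine ⟨q, hqp, ?_, ?_⟩
  · rw [isCentralIdeal_iff K]
    intro c d hd hs
    by_contra hc
    have hlt : q < q ⊔ Ideal.span {c} := Submodule.lt_sup_iff_notMem.mpr hc
    obtain ⟨m, hmJ, a, ha, ham⟩ := Set.not_disjoint_iff.mp (hqm _ hlt)
    obtain ⟨r, hr, t, ht, rfl⟩ := Submodule.mem_sup.mp hmJ
    obtain ⟨u, rfl⟩ := Ideal.mem_span_singleton'.mp ht
    -- For `m = r + u c` in `M`, the element `m ^ 2 + u ^ 2 (d - c ^ 2)` lies both in `q` and in `M`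
    refine Set.disjoint_left.mp hqd (?_ : (r + u * c) ^ 2 + u ^ 2 * (d - c ^ 2) ∈ q) ?_
    · have e : (r + u * c) ^ 2 + u ^ 2 * (d - c ^ 2) = (r + 2 * (u * c)) * r + u ^ 2 * d := by ring
      rw [e]
      exact q.add_mem (q.mul_mem_left _ hr) (q.mul_mem_left _ hd)
    · obtain ⟨b, hb, hbs⟩ := M.pow_mem ⟨a, ha, ham⟩ 2
      refine ⟨b, hb, ?_⟩
      refine (hbs.add ((IsSumSq.sq (algebraMap C K u)).mul hs)).of_eq ?_
      simp only [map_add, map_mul, map_pow, map_sub]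
      ring
  · refine le_antisymm (fun a ha => ?_) (Ideal.map_le_iff_le_comap.mp hpq)
    by_contra hap
    refine Set.disjoint_left.mp hqd (q.pow_mem_of_mem ha 2 (by norm_num)) ⟨a, hap, ?_⟩
    simp

end Central

/-! ### Centrally subintegral extensions -/

section Subintegral

variable {A C E B : Type*} [CommRing A] [CommRing C] [CommRing E] [CommRing B]

/-- The residue field extension at `q` is trivial if and only if every element of `C` is congruent
modulo `q` to a fraction whose numerator and denominator come from `A`. -/
theorem bijective_residueFieldMap_iff (φ : A →+* C) (q : Ideal C) [q.IsPrime] :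
    Function.Bijective (Ideal.ResidueField.map (q.comap φ) q φ rfl) ↔
      ∀ c, ∃ s, φ s ∉ q ∧ ∃ a, φ s * c - φ a ∈ q := by
  set p := q.comap φ with hp
  set ψ := Ideal.ResidueField.map p q φ rfl with hψ
  have hψa : ∀ a, ψ (algebraMap A _ a) = algebraMap C _ (φ a) :=
    Ideal.ResidueField.map_algebraMap _ _ φ rfl
  constructor
  · intro h c
    obtain ⟨z, hz⟩ := h.2 (algebraMap C _ c)
    obtain ⟨a, s, hs, rfl⟩ := IsFractionRing.div_surjective (A ⧸ p) z
    obtain ⟨a, rfl⟩ := Ideal.Quotient.mk_surjective a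
    obtain ⟨s, rfl⟩ := Ideal.Quotient.mk_surjective s
    have hs' : φ s ∉ q := fun h0 =>
      nonZeroDivisors.ne_zero hs (Ideal.Quotient.eq_zero_iff_mem.mpr h0)
    refine ⟨s, hs', a, ?_⟩
    rw [Ideal.algebraMap_quotient_residueField_mk, Ideal.algebraMap_quotient_residueField_mk,
      map_div₀, hψa, hψa] at hz
    have hs0 : algebraMap C q.ResidueField (φ s) ≠ 0 := fun h0 =>
      hs' (Ideal.algebraMap_residueField_eq_zero.mp h0)
    rw [← Ideal.algebraMap_residueField_eq_zero (I := q), map_sub, map_mul, ← hz]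
    field_simp
    ring
  · intro h
    refine ⟨ψ.injective, fun w => ?_⟩
    have key : ∀ c, algebraMap C q.ResidueField c ∈ ψ.fieldRange := fun c => by
      obtain ⟨s, hs, a, hsa⟩ := h c
      have hs0 : algebraMap C q.ResidueField (φ s) ≠ 0 := fun h0 =>
        hs (Ideal.algebraMap_residueField_eq_zero.mp h0)
      rw [← Ideal.algebraMap_residueField_eq_zero (I := q), map_sub, map_mul, sub_eq_zero] at hsa
      have e : algebraMap C q.ResidueField c = ψ (algebraMap A _ a) / ψ (algebraMap A _ s) := by
        rw [hψa, hψa, ← hsa]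
        field_simp
      rw [e]
      exact div_mem ⟨_, rfl⟩ ⟨_, rfl⟩
    obtain ⟨c, d, -, rfl⟩ := IsFractionRing.div_surjective (C ⧸ q) w
    obtain ⟨c, rfl⟩ := Ideal.Quotient.mk_surjective c
    obtain ⟨d, rfl⟩ := Ideal.Quotient.mk_surjective d
    rw [Ideal.algebraMap_quotient_residueField_mk, Ideal.algebraMap_quotient_residueField_mk]
    exact div_mem (key c) (key d)

/-- Being centrally subintegral is invariant under isomorphisms of the target. -/
theorem IsCentrallySubintegral.ringEquiv_comp [IsDomain C] [IsDomain E] {φ : A →+* C}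
    (h : IsCentrallySubintegral φ) (e : C ≃+* E) :
    IsCentrallySubintegral ((e : C →+* E).comp φ) := by
  have hE : ∀ q ∈ centralSpectrum E, PrimeSpectrum.comap (e : C →+* E) q ∈ centralSpectrum C :=
    fun q hq => IsCentralIdeal.comap (φ := (e : C →+* E)) e.injective hq
  refine ⟨e.injective.comp h.injective, ?_, ⟨?_, ?_, ?_⟩, ?_⟩
  · exact h.integral.trans _ _ (RingHom.isIntegral_of_surjective _ e.surjective)
  · intro q hq
    exact h.bijOn.mapsTo (hE q hq)
  · intro q hq q' hq' hqq'
    exact PrimeSpectrum.comap_injective_of_surjective (e : C →+* E) e.surjective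
      (h.bijOn.injOn (hE q hq) (hE q' hq') hqq')
  · intro p hp
    obtain ⟨q, hq, rfl⟩ := h.bijOn.surjOn hp
    refine ⟨PrimeSpectrum.comap (e.symm : E →+* C) q,
      IsCentralIdeal.comap (φ := (e.symm : E →+* C)) e.symm.injective hq, ?_⟩
    ext a
    simp
  · intro q hq
    rw [bijective_residueFieldMap_iff]
    intro c
    obtain ⟨s, hs, a, hsa⟩ :=
      (bijective_residueFieldMap_iff φ _).mp (h.equiresidual _ (hE q hq)) (e.symm c)
    refine ⟨s, hs, a, ?_⟩
    rw [PrimeSpectrum.comap_asIdeal, Ideal.mem_comap] at hsa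
    simpa using hsa

/-- If `K(A)` is not formally real, then no extension of `A` has central primes. -/
theorem centralSpectrum_eq_empty_of_injective [IsDomain A] [IsDomain C]
    (h : ¬ IsCentralIdeal (⊥ : Ideal A)) {φ : A →+* C} (hφ : Function.Injective φ) :
    centralSpectrum C = ∅ := by
  refine Set.eq_empty_of_forall_notMem fun q hq => ?_
  exact (IsCentralIdeal.comap hφ hq).not_isSumSq_neg_one (q.isPrime.comap φ).ne_top
    (FractionRing A) (isSumSq_neg_one_of_not_isCentralIdeal_bot _ h)

variable [IsDomain C] [IsDomain E] [Algebra A C] [Algebra C E] [Algebra A E]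
  [IsScalarTower A C E]

/-- If `C` is centrally subintegral over `A`, all central primes of `E` over `p` meet `C` in the
same prime, whose residue field is that of `p`. -/
theorem IsCentrallySubintegral.exists_forall (h : IsCentrallySubintegral (algebraMap A C))
    (hCE : Function.Injective (algebraMap C E)) (p : PrimeSpectrum A) (hp : p ∈ centralSpectrum A)
    (c : C) : ∃ s ∉ p.asIdeal, ∃ a, ∀ q ∈ centralSpectrum E,
      PrimeSpectrum.comap (algebraMap A E) q = p →
        algebraMap A E s * algebraMap C E c - algebraMap A E a ∈ q.asIdeal := by
  obtain ⟨q, hq, rfl⟩ := h.bijOn.surjOn hp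
  obtain ⟨s, hs, a, hsa⟩ := (bijective_residueFieldMap_iff _ _).mp (h.equiresidual q hq) c
  refine ⟨s, hs, a, fun r hr hrq => ?_⟩
  have e : PrimeSpectrum.comap (algebraMap C E) r = q := by
    refine h.bijOn.injOn (IsCentralIdeal.comap hCE hr) hq ?_
    rw [← hrq, IsScalarTower.algebraMap_eq A C E]
    rfl
  rw [← e] at hsa
  simpa only [PrimeSpectrum.comap_asIdeal, Ideal.mem_comap, map_sub, map_mul,
    ← IsScalarTower.algebraMap_apply A C E] using hsa

variable [IsDomain A]

/-- Let `E` be integral and birational over `A`, and let `A ⊆ C ⊆ E`. If each element of `C` is,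
simultaneously at all central primes of `E` over a given central prime of `A`, congruent to the
same fraction of elements of `A`, then `C` is centrally subintegral over `A`. -/
theorem isCentrallySubintegral_of_forall_exists [Algebra.IsIntegral A E]
    (hAC : Function.Injective (algebraMap A C)) (hCE : Function.Injective (algebraMap C E))
    (hbir : IsBirationalExtension A E)
    (H : ∀ p ∈ centralSpectrum A, ∀ c : C, ∃ s ∉ p.asIdeal, ∃ a, ∀ q ∈ centralSpectrum E,
      PrimeSpectrum.comap (algebraMap A E) q = p →
        algebraMap A E s * algebraMap C E c - algebraMap A E a ∈ q.asIdeal) :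
    IsCentrallySubintegral (algebraMap A C) := by
  have hAE : Function.Injective (algebraMap A E) := by
    rw [IsScalarTower.algebraMap_eq A C E]; exact hCE.comp hAC
  have : Algebra.IsIntegral C E := Algebra.IsIntegral.tower_top A
  have hbirC : IsBirationalExtension C E := fun e => by
    obtain ⟨s, hs, a, ha⟩ := hbir e
    refine ⟨algebraMap A C s, fun h0 => hs (hAC (by simpa using h0)), algebraMap A C a, ?_⟩
    simpa only [← IsScalarTower.algebraMap_apply A C E] using ha
  have hcomp : (PrimeSpectrum.comap (algebraMap A C)) ∘ (PrimeSpectrum.comap (algebraMap C E)) =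
      PrimeSpectrum.comap (algebraMap A E) := by
    rw [IsScalarTower.algebraMap_eq A C E]; rfl
  have lift : ∀ q ∈ centralSpectrum C, ∃ r ∈ centralSpectrum E,
      PrimeSpectrum.comap (algebraMap C E) r = q := fun q hq => by
    obtain ⟨r, hr, hrc, hrq⟩ := exists_central_prime_comap_eq hCE hbirC q.asIdeal hq
    exact ⟨⟨r, hr⟩, hrc, PrimeSpectrum.ext hrq⟩
  have maps : Set.MapsTo (PrimeSpectrum.comap (algebraMap A C)) (centralSpectrum C)
      (centralSpectrum A) := fun q hq => IsCentralIdeal.comap hAC hq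
  -- The congruences at central primes of `E` descend to `C`, by lying over.
  have HC : ∀ p ∈ centralSpectrum A, ∀ c : C, ∃ s ∉ p.asIdeal, ∃ a, ∀ q ∈ centralSpectrum C,
      PrimeSpectrum.comap (algebraMap A C) q = p →
        algebraMap A C s * c - algebraMap A C a ∈ q.asIdeal := fun p hp c => by
    obtain ⟨s, hs, a, h⟩ := H p hp c
    refine ⟨s, hs, a, fun q hq hqp => ?_⟩
    obtain ⟨r, hr, rfl⟩ := lift q hq
    have := h r hr (by rw [← hqp, ← hcomp]; rfl)
    change algebraMap C E _ ∈ r.asIdeal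
    simpa only [map_sub, map_mul, ← IsScalarTower.algebraMap_apply A C E] using this
  refine ⟨hAC, ?_, ⟨maps, ?_, ?_⟩, ?_⟩
  · exact algebraMap_isIntegral_iff.mpr
      (Algebra.IsIntegral.of_injective (IsScalarTower.toAlgHom A C E) hCE)
  · intro q hq q' hq' hqq'
    ext c
    obtain ⟨s, hs, a, h⟩ := HC _ (maps hq) c
    have mem_iff : ∀ r ∈ centralSpectrum C, PrimeSpectrum.comap (algebraMap A C) r =
        PrimeSpectrum.comap (algebraMap A C) q →
        (c ∈ r.asIdeal ↔ a ∈ (PrimeSpectrum.comap (algebraMap A C) q).asIdeal) := by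
      intro r hr hrq
      have hs' : algebraMap A C s ∉ r.asIdeal := by
        rw [← hrq] at hs; exact hs
      have hsc := h r hr hrq
      rw [← hrq]
      change _ ↔ algebraMap A C a ∈ r.asIdeal
      rw [← Ideal.neg_mem_iff r.asIdeal (a := algebraMap A C a)]
      constructor
      · intro hc
        have := r.asIdeal.sub_mem hsc (r.asIdeal.mul_mem_left (algebraMap A C s) hc)
        simpa using this
      · intro ha
        have := r.asIdeal.sub_mem hsc ha
        simp only [sub_neg_eq_add, sub_add_cancel] at this
        exact (r.isPrime.mem_or_mem this).resolve_left hs'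
    rw [mem_iff q hq rfl, mem_iff q' hq' hqq'.symm]
  · intro p hp
    obtain ⟨r, hr, hrc, hrp⟩ := exists_central_prime_comap_eq hAE hbir p.asIdeal hp
    refine ⟨PrimeSpectrum.comap (algebraMap C E) ⟨r, hr⟩, IsCentralIdeal.comap hCE hrc, ?_⟩
    exact (congrFun hcomp _).trans (PrimeSpectrum.ext hrp)
  · intro q hq
    rw [bijective_residueFieldMap_iff]
    intro c
    obtain ⟨s, hs, a, h⟩ := HC _ (maps hq) c
    exact ⟨s, hs, a, h q hq rfl⟩

/-- Over a domain with formally real fraction field, centrally subintegral extensions are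
birational: the zero ideal is the only prime over the central prime `0`. -/
theorem IsCentrallySubintegral.isBirationalExtension
    (h : IsCentrallySubintegral (algebraMap A C)) (hA : IsCentralIdeal (⊥ : Ideal A)) :
    IsBirationalExtension A C := by
  intro c
  have : Algebra.IsIntegral A C := algebraMap_isIntegral_iff.mp h.integral
  obtain ⟨q, hq, hqp⟩ := h.bijOn.surjOn (show (⊥ : PrimeSpectrum A) ∈ centralSpectrum A from hA)
  have hq0 : q.asIdeal = ⊥ :=
    Ideal.eq_bot_of_comap_eq_bot (R := A) (congrArg PrimeSpectrum.asIdeal hqp)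
  obtain ⟨s, hs, a, hsa⟩ := (bijective_residueFieldMap_iff _ _).mp (h.equiresidual q hq) c
  rw [hq0, Ideal.mem_bot] at hs hsa
  exact ⟨s, fun h0 => hs (by rw [h0, map_zero]), a, sub_eq_zero.mp hsa⟩

end Subintegral

/-! ### The central seminormalization of an extension of domains -/

section Seminormalization

variable {A B : Type*} [CommRing A] [CommRing B] [IsDomain A] [IsDomain B]

/-- The elements of `B` which are integral over `A` and fractions of elements of `A`: the largest
integral birational extension of `A` in `B`. -/
def birationalClosure (φ : A →+* B) : Subring B where
  carrier := {b | φ.IsIntegralElem b ∧ ∃ s : A, s ≠ 0 ∧ ∃ a, φ s * b = φ a}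
  one_mem' := ⟨φ.isIntegralElem_one, 1, one_ne_zero, 1, by simp⟩
  zero_mem' := ⟨φ.isIntegralElem_zero, 1, one_ne_zero, 0, by simp⟩
  add_mem' := by
    rintro x y ⟨hx, s, hs, a, hsa⟩ ⟨hy, t, ht, b, htb⟩
    refine ⟨hx.add φ hy, s * t, mul_ne_zero hs ht, t * a + s * b, ?_⟩
    simp only [map_mul, map_add, ← hsa, ← htb]
    ring
  mul_mem' := by
    rintro x y ⟨hx, s, hs, a, hsa⟩ ⟨hy, t, ht, b, htb⟩
    refine ⟨hx.mul φ hy, s * t, mul_ne_zero hs ht, a * b, ?_⟩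
    simp only [map_mul, ← hsa, ← htb]
    ring
  neg_mem' := by
    rintro x ⟨hx, s, hs, a, hsa⟩
    exact ⟨hx.neg φ, s, hs, -a, by simp [hsa]⟩

/-- Given `A → E`, the elements of `E` which, for every central prime `p` of `A`, are congruent to
one and the same fraction of elements of `A` modulo all central primes of `E` over `p`. -/
def centralGluing {E : Type*} [CommRing E] (φ : A →+* E) : Subring E where
  carrier := {b | ∀ p ∈ centralSpectrum A, ∃ s ∉ p.asIdeal, ∃ a, ∀ q ∈ centralSpectrum E,
    PrimeSpectrum.comap φ q = p → φ s * b - φ a ∈ q.asIdeal}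
  one_mem' p _ := ⟨1, (Ideal.ne_top_iff_one _).mp p.isPrime.ne_top, 1, fun q _ _ => by simp⟩
  zero_mem' p _ := ⟨1, (Ideal.ne_top_iff_one _).mp p.isPrime.ne_top, 0, fun q _ _ => by simp⟩
  add_mem' := by
    intro x y hx hy p hp
    obtain ⟨s, hs, a, h⟩ := hx p hp
    obtain ⟨t, ht, b, h'⟩ := hy p hp
    refine ⟨s * t, fun h0 => (p.isPrime.mem_or_mem h0).elim hs ht, t * a + s * b,
      fun q hq hqp => ?_⟩
    have := q.asIdeal.add_mem (q.asIdeal.mul_mem_left (φ t) (h q hq hqp))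
      (q.asIdeal.mul_mem_left (φ s) (h' q hq hqp))
    convert this using 1
    simp only [map_mul, map_add]
    ring
  mul_mem' := by
    intro x y hx hy p hp
    obtain ⟨s, hs, a, h⟩ := hx p hp
    obtain ⟨t, ht, b, h'⟩ := hy p hp
    refine ⟨s * t, fun h0 => (p.isPrime.mem_or_mem h0).elim hs ht, a * b, fun q hq hqp => ?_⟩
    have := q.asIdeal.add_mem (q.asIdeal.mul_mem_left (φ t * y) (h q hq hqp))
      (q.asIdeal.mul_mem_left (φ a) (h' q hq hqp))
    convert this using 1
    simp only [map_mul]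
    ring
  neg_mem' := by
    intro x hx p hp
    obtain ⟨s, hs, a, h⟩ := hx p hp
    refine ⟨s, hs, -a, fun q hq hqp => ?_⟩
    have := q.asIdeal.neg_mem (h q hq hqp)
    convert this using 1
    simp only [map_neg]
    ring

/-- For `A ⊆ C ⊆ E` with `E` integral and birational over `A`, the extension `A ⊆ C` is centrally
subintegral if and only if `C` is contained in the central gluing. -/
theorem isCentrallySubintegral_iff_le_centralGluing {C E : Type*} [CommRing C] [CommRing E]
    [IsDomain C] [IsDomain E] (φ : A →+* C) (ψ : C →+* E) (hφ : Function.Injective φ)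
    (hψ : Function.Injective ψ) (hint : (ψ.comp φ).IsIntegral)
    (hbir : ∀ e, ∃ s : A, s ≠ 0 ∧ ∃ a, ψ.comp φ s * e = ψ.comp φ a) :
    IsCentrallySubintegral φ ↔ ψ.range ≤ centralGluing (ψ.comp φ) := by
  let := φ.toAlgebra
  let := ψ.toAlgebra
  let := (ψ.comp φ).toAlgebra
  have : IsScalarTower A C E := .of_algebraMap_eq' rfl
  have : Algebra.IsIntegral A E := algebraMap_isIntegral_iff.mp hint
  constructor
  · rintro h _ ⟨c, rfl⟩ p hp
    exact IsCentrallySubintegral.exists_forall (C := C) (E := E) h hψ p hp c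
  · intro h
    exact isCentrallySubintegral_of_forall_exists (C := C) (E := E) hφ hψ hbir
      fun p hp c => h ⟨c, rfl⟩ p hp

/-- For every extension `A → B` of domains there is a subring `D` of `B`, integral over `A`, such
that the intermediate rings centrally subintegral over `A` are exactly those contained in `D`.
If `K(A)` is formally real, `D` is the central gluing of `A` in its birational closure in `B`;
otherwise there are no central primes at all, and `D` is the integral closure of `A` in `B`. -/
theorem exists_subring_isCentrallySubintegral_iff_le (φ : A →+* B) (hφ : Function.Injective φ) :
    ∃ D : Subring B, (∀ a, φ a ∈ D) ∧ (∀ d ∈ D, φ.IsIntegralElem d) ∧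
      ∀ (C : Subring B) (h : ∀ a, φ a ∈ C),
        IsCentrallySubintegral (φ.codRestrict C h) ↔ C ≤ D := by
  have inj : ∀ (C : Subring B) (h : ∀ a, φ a ∈ C), Function.Injective (φ.codRestrict C h) :=
    fun C h x y hxy => hφ (congrArg Subtype.val hxy)
  have int_iff : ∀ (C : Subring B) (h : ∀ a, φ a ∈ C),
      (φ.codRestrict C h).IsIntegral ↔ ∀ c ∈ C, φ.IsIntegralElem c := by
    intro C h
    have : ∀ c : C, (φ.codRestrict C h).IsIntegralElem c ↔ φ.IsIntegralElem (c : B) := by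
      intro c
      refine exists_congr fun P => and_congr_right fun _ => ?_
      rw [← Subtype.val_injective.eq_iff]
      change C.subtype (P.eval₂ (φ.codRestrict C h) c) = 0 ↔ _
      rw [Polynomial.hom_eval₂]
      rfl
    exact ⟨fun H c hc => (this ⟨c, hc⟩).mp (H ⟨c, hc⟩), fun H c => (this c).mpr (H c c.2)⟩
  by_cases hA : IsCentralIdeal (⊥ : Ideal A)
  · set B' := birationalClosure φ with hB'
    have hφB' : ∀ a, φ a ∈ B' := fun a => ⟨φ.isIntegralElem_map, 1, one_ne_zero, a, by simp⟩
    set φ' := φ.codRestrict B' hφB' with hφ'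
    have hmem : ∀ b : B', (b : B) ∈ (centralGluing φ').map B'.subtype ↔ b ∈ centralGluing φ' :=
      fun b => ⟨by rintro ⟨x, hx, hxb⟩; rwa [← Subtype.ext hxb], fun hb => ⟨b, hb, rfl⟩⟩
    have hle : (centralGluing φ').map B'.subtype ≤ B' := by
      rintro _ ⟨x, -, rfl⟩; exact x.2
    have main : ∀ (C : Subring B) (h : ∀ a, φ a ∈ C), C ≤ B' →
        (IsCentrallySubintegral (φ.codRestrict C h) ↔
          C ≤ (centralGluing φ').map B'.subtype) := by
      intro C h hC
      have e : (Subring.inclusion hC).comp (φ.codRestrict C h) = φ' := rfl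
      rw [isCentrallySubintegral_iff_le_centralGluing (φ.codRestrict C h) (Subring.inclusion hC)
        (inj C h) (Subring.inclusion_injective hC), e]
      · constructor
        · intro H c hc
          exact ⟨_, H ⟨⟨c, hc⟩, rfl⟩, rfl⟩
        · rintro H _ ⟨c, rfl⟩
          exact (hmem _).mp (H c.2)
      · rw [e]
        exact (int_iff B' hφB').mpr fun c hc => hc.1
      · intro b
        obtain ⟨s, hs, a, hsa⟩ := b.2.2
        exact ⟨s, hs, a, Subtype.ext hsa⟩
    refine ⟨(centralGluing φ').map B'.subtype, fun a => ?_, fun d hd => (hle hd).1,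
      fun C h => ⟨fun hC => ?_, fun hC => (main C h (hC.trans hle)).mpr hC⟩⟩
    · refine ⟨φ' a, fun p _ => ⟨1, (Ideal.ne_top_iff_one _).mp p.isPrime.ne_top, a,
        fun q _ _ => by simp⟩, rfl⟩
    · refine (main C h fun c hc => ⟨(int_iff C h).mp hC.integral c hc, ?_⟩).mp hC
      let := (φ.codRestrict C h).toAlgebra
      obtain ⟨s, hs, a, hsa⟩ := IsCentrallySubintegral.isBirationalExtension (C := C) hC hA ⟨c, hc⟩
      exact ⟨s, hs, a, congrArg Subtype.val hsa⟩
  · let := φ.toAlgebra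
    refine ⟨(integralClosure A B).toSubring, fun a => (integralClosure A B).algebraMap_mem a,
      fun d hd => hd, fun C h => ⟨fun hC => (int_iff C h).mp hC.integral, fun hC => ?_⟩⟩
    have hC0 := centralSpectrum_eq_empty_of_injective hA (inj C h)
    have hA0 := centralSpectrum_eq_empty_of_injective hA (φ := RingHom.id A) fun _ _ h => h
    refine ⟨inj C h, (int_iff C h).mpr hC, ?_, ?_⟩
    · rw [hC0, hA0]
      exact Set.bijOn_empty _
    · simp [hC0]

end Seminormalization

/-! ### Finiteness -/

section Finiteness

open scoped TensorProduct

/-- Let `P` be an integrally closed Noetherian domain of characteristic zero, and `P ⊆ D ⊆ B` with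
`D` integral over `P` and `B` a domain of finite type over `P`. Then `D` is finite over `P`.

A residue field `L` of the `K(P)`-algebra `K(P) ⊗ B` is finite over `K(P)` by the Nullstellensatz,
and `D` embeds into `L`, hence into the integral closure of `P` in `L`. -/
theorem Module.Finite.of_isIntegral_of_finiteType_extension {P D B : Type*} [CommRing P]
    [IsDomain P] [IsNoetherianRing P] [IsIntegrallyClosed P] [CharZero P] [CommRing D] [IsDomain D]
    [CommRing B] [IsDomain B] [Algebra P D] [Algebra P B] [Algebra D B] [IsScalarTower P D B]
    [Algebra.FiniteType P B] [Algebra.IsIntegral P D]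
    (hPB : Function.Injective (algebraMap P B)) : Module.Finite P D := by
  let K := FractionRing P
  let T := K ⊗[P] B
  have : FaithfulSMul P B := (faithfulSMul_iff_algebraMap_injective P B).mpr hPB
  have : FaithfulSMul P (FractionRing B) := by
    rw [faithfulSMul_iff_algebraMap_injective, IsScalarTower.algebraMap_eq P B]
    exact (IsFractionRing.injective B (FractionRing B)).comp hPB
  have : Nontrivial T := (Algebra.TensorProduct.productMap
    (IsLocalization.liftAlgHom (M := nonZeroDivisors P) (S := K)
      (f := Algebra.ofId P (FractionRing B)) fun y => IsUnit.mk0 _ fun h0 =>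
        nonZeroDivisors.coe_ne_zero y (FaithfulSMul.algebraMap_injective P (FractionRing B)
          (h0.trans (map_zero _).symm)))
    (IsScalarTower.toAlgHom P B (FractionRing B))).toRingHom.domain_nontrivial
  obtain ⟨m, hm⟩ := Ideal.exists_maximal T
  let := Ideal.Quotient.field m
  let L := T ⧸ m
  have : Module.Finite K L := finite_of_finite_type_of_isJacobsonRing K L
  have : CharZero K := charZero_of_injective_algebraMap (IsFractionRing.injective P K)
  let j : D →ₐ[P] L := (Ideal.Quotient.mkₐ P m).comp
    ((Algebra.TensorProduct.includeRight).comp (IsScalarTower.toAlgHom P D B))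
  have hPL : Function.Injective (algebraMap P L) := by
    rw [IsScalarTower.algebraMap_eq P K L]
    exact (algebraMap K L).injective.comp (IsFractionRing.injective P K)
  have hj : Function.Injective j := by
    rw [RingHom.injective_iff_ker_eq_bot]
    refine Ideal.eq_bot_of_comap_eq_bot (R := P) ?_
    rw [eq_bot_iff]
    intro x hx
    rw [Ideal.mem_comap, RingHom.mem_ker, AlgHom.commutes] at hx
    exact hPL (hx.trans (map_zero _).symm)
  have := IsIntegralClosure.isNoetherian P K L (integralClosure P L)
  let j' : D →ₐ[P] integralClosure P L := j.codRestrict _ fun d =>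
    (Algebra.IsIntegral.isIntegral (R := P) d).map j
  have hj' : Function.Injective j'.toLinearMap := fun x y h => hj (congrArg Subtype.val h)
  have := isNoetherian_of_injective j'.toLinearMap hj'
  infer_instance

/-- If `A ⊆ B` are domains of finite type over a field of characteristic zero, then each
intermediate ring integral over `A` is of finite type. -/
theorem RingHom.FiniteType.codRestrict_of_isIntegral {k A B : Type*} [Field k] [CharZero k]
    [CommRing A] [CommRing B] [IsDomain A] [IsDomain B] {ι : k →+* A} (hι : ι.FiniteType)
    {φ : A →+* B} (hφ : Function.Injective φ) (hft : φ.FiniteType) (D : Subring B)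
    (h : ∀ a, φ a ∈ D) (hD : ∀ d ∈ D, φ.IsIntegralElem d) :
    ((φ.codRestrict D h).comp ι).FiniteType := by
  let := ι.toAlgebra
  have : Algebra.FiniteType k A := hι
  obtain ⟨s, g, hg, hgf⟩ := exists_finite_inj_algHom_of_fg k A
  let P := MvPolynomial (Fin s) k
  let := g.toRingHom.toAlgebra
  let := (φ.comp g.toRingHom).toAlgebra
  let := ((φ.codRestrict D h).comp g.toRingHom).toAlgebra
  have : IsScalarTower P D B := .of_algebraMap_eq' rfl
  have : Algebra.FiniteType P B := hft.comp hgf.finiteType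
  have hPB : Function.Injective (algebraMap P B) := hφ.comp hg
  have : Algebra.IsIntegral P D := by
    refine ⟨fun d => ?_⟩
    have hd : _root_.IsIntegral P (d : B) := by
      let := φ.toAlgebra
      have : IsScalarTower P A B := .of_algebraMap_eq' rfl
      have : Algebra.IsIntegral P A := algebraMap_isIntegral_iff.mp hgf.to_isIntegral
      exact isIntegral_trans (R := P) (A := A) _ (hD d d.2)
    exact (isIntegral_algHom_iff (IsScalarTower.toAlgHom P D B) Subtype.val_injective).mp hd
  have : Module.Finite P D := .of_isIntegral_of_finiteType_extension hPB
  have e : (φ.codRestrict D h).comp ι = (algebraMap P D).comp (algebraMap k P) := by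
    ext x
    change φ (algebraMap k A x) = φ (g (algebraMap k P x))
    rw [g.commutes]
  rw [e]
  exact (RingHom.finiteType_algebraMap.mpr (inferInstance : Algebra.FiniteType P D)).comp
    (RingHom.finiteType_algebraMap.mpr inferInstance)

end Finiteness

/-! ### Affine varieties and their coordinate rings -/

/-- Morphisms to an affine scheme may be prescribed on global sections. -/
theorem AlgebraicGeometry.exists_appTop_eq {X Y : Scheme} [IsAffine Y] (g : Γ(Y, ⊤) ⟶ Γ(X, ⊤)) :
    ∃ t : X ⟶ Y, t.appTop = g := by
  refine ⟨X.toSpecΓ ≫ Spec.map g ≫ Y.isoSpec.inv, ?_⟩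
  obtain ⟨t, ht⟩ : ∃ t, t = X.toSpecΓ ≫ Spec.map g ≫ Y.isoSpec.inv := ⟨_, rfl⟩
  rw [← ht]
  have h : t ≫ Y.toSpecΓ = X.toSpecΓ ≫ Spec.map g := by simp [ht]
  have h' := congrArg Scheme.Hom.appTop h
  rw [Scheme.Hom.comp_appTop, Scheme.Hom.comp_appTop, Scheme.toSpecΓ_appTop,
    Scheme.toSpecΓ_appTop, Scheme.ΓSpecIso_naturality] at h'
  exact (cancel_epi _).mp h'

section Varieties

variable {U V W X Y : Over (Spec (CommRingCat.of ℝ))}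

theorem coordinateMap_comp (s : U ⟶ V) (t : V ⟶ W) :
    coordinateMap (s ≫ t) = (coordinateMap s).comp (coordinateMap t) := by
  rw [coordinateMap, Over.comp_left, Scheme.Hom.comp_appTop]
  rfl

/-- A morphism to an affine variety is determined by its coordinate map. -/
theorem eq_of_coordinateMap_eq (hW : IsIrreducibleAffineRealVariety W) {s t : V ⟶ W}
    (h : coordinateMap s = coordinateMap t) : s = t := by
  have := hW.isAffine
  exact Over.OverMorphism.ext (ext_of_isAffine (CommRingCat.hom_ext h))

theorem coordinateMap_comp_realStructure (t : V ⟶ W) :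
    (coordinateMap t).comp (realStructure W) = realStructure V := by
  rw [realStructure, realStructure, ← Over.w t, Scheme.Hom.comp_appTop, ← Category.assoc]
  rfl

/-- A homomorphism of `ℝ`-algebras between coordinate rings comes from a morphism. -/
theorem exists_coordinateMap_eq (hW : IsIrreducibleAffineRealVariety W)
    (g : coordinateRing W →+* coordinateRing V)
    (hg : g.comp (realStructure W) = realStructure V) : ∃ t : V ⟶ W, coordinateMap t = g := by
  have := hW.isAffine
  obtain ⟨t, ht⟩ := exists_appTop_eq (CommRingCat.ofHom g)
  refine ⟨Over.homMk t (ext_of_isAffine ?_), congrArg CommRingCat.Hom.hom ht⟩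
  have h : (Scheme.ΓSpecIso (CommRingCat.of ℝ)).inv ≫ W.hom.appTop ≫ CommRingCat.ofHom g =
      (Scheme.ΓSpecIso (CommRingCat.of ℝ)).inv ≫ V.hom.appTop :=
    CommRingCat.hom_ext hg
  rw [Scheme.Hom.comp_appTop, ht]
  exact (cancel_epi _).mp h

theorem IsIrreducibleAffineRealVariety.isDomain (hX : IsIrreducibleAffineRealVariety X) :
    IsDomain (coordinateRing X) := by
  have := hX.isIntegral
  infer_instance

theorem IsIrreducibleAffineRealVariety.finiteType_realStructure
    (hX : IsIrreducibleAffineRealVariety X) : (realStructure X).FiniteType := by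
  have := hX.isAffine
  have h : X.hom.appTop.hom.FiniteType :=
    HasRingHomProperty.appTop @LocallyOfFiniteType X.hom hX.locallyOfFiniteType
  exact h.comp (RingHom.FiniteType.of_surjective _
    (Scheme.ΓSpecIso (CommRingCat.of ℝ)).symm.commRingCatIsoToRingEquiv.surjective)

/-- Every domain which is a finitely generated `ℝ`-algebra is the coordinate ring of an irreducible
affine variety. -/
theorem exists_isIrreducibleAffineRealVariety {R : Type} [CommRing R] [IsDomain R] {ψ : ℝ →+* R}
    (hψ : ψ.FiniteType) : ∃ V, IsIrreducibleAffineRealVariety V ∧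
      ∃ e : coordinateRing V ≃+* R, (e : coordinateRing V →+* R).comp (realStructure V) = ψ := by
  refine ⟨Over.mk (Spec.map (CommRingCat.ofHom ψ)), ⟨?_, ?_, ?_⟩,
    (Scheme.ΓSpecIso (CommRingCat.of R)).commRingCatIsoToRingEquiv, ?_⟩
  · exact inferInstanceAs (IsAffine (Spec (CommRingCat.of R)))
  · exact inferInstanceAs (IsIntegral (Spec (CommRingCat.of R)))
  · exact (HasRingHomProperty.Spec_iff (P := @LocallyOfFiniteType)).mpr hψ
  · have h := Scheme.ΓSpecIso_naturality (CommRingCat.ofHom ψ)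
    have h' : ((Scheme.ΓSpecIso (CommRingCat.of ℝ)).inv ≫ (Spec.map (CommRingCat.ofHom ψ)).appTop) ≫
        (Scheme.ΓSpecIso (CommRingCat.of R)).hom = CommRingCat.ofHom ψ := by
      rw [Category.assoc, h, Iso.inv_hom_id_assoc]
    exact congrArg CommRingCat.Hom.hom h'

theorem coordinateMap_injective_of_isDominant (hX : IsIrreducibleAffineRealVariety X)
    (hY : IsIrreducibleAffineRealVariety Y) (f : Y ⟶ X) (hf : IsDominant f.left) :
    Function.Injective (coordinateMap f) := by
  have := hX.isIntegral
  have := hX.isAffine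
  have := hY.isAffine
  have := IsSchemeTheoreticallyDominant.of_isDominant f.left
  exact f.left.app_injective ⊤

end Varieties

namespace IntermediateVariety

variable {X Y : Over (Spec (CommRingCat.of ℝ))} {f : Y ⟶ X}

theorem injective_coordinateMap_fromY (hY : IsIrreducibleAffineRealVariety Y)
    (V : IntermediateVariety f) : Function.Injective (coordinateMap V.fromY) :=
  coordinateMap_injective_of_isDominant V.isVariety hY _ V.dominant

theorem coordinateMap_fromY_comp_toX (V : IntermediateVariety f) :
    (coordinateMap V.fromY).comp (coordinateMap V.toX) = coordinateMap f := by
  rw [← coordinateMap_comp, V.fac]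

theorem coordinateMap_mem_range (V : IntermediateVariety f) (a : coordinateRing X) :
    coordinateMap f a ∈ (coordinateMap V.fromY).range :=
  ⟨coordinateMap V.toX a, RingHom.congr_fun V.coordinateMap_fromY_comp_toX a⟩

/-- Central subintegrality may be tested on the image of `ℝ[V]` in `ℝ[Y]`, which is isomorphic to
`ℝ[V]`. -/
theorem centrallySubintegral_iff_range (hY : IsIrreducibleAffineRealVariety Y)
    (V : IntermediateVariety f) : V.CentrallySubintegral ↔
      IsCentrallySubintegral ((coordinateMap f).codRestrict (coordinateMap V.fromY).range
        V.coordinateMap_mem_range) := by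
  have := V.isVariety.isDomain
  have := hY.isDomain
  let e : coordinateRing V.V ≃+* (coordinateMap V.fromY).range :=
    RingEquiv.ofBijective (coordinateMap V.fromY).rangeRestrict
      ⟨fun x y h => V.injective_coordinateMap_fromY hY (congrArg Subtype.val h),
        (coordinateMap V.fromY).rangeRestrict_surjective⟩
  have he : (e : _ →+* (coordinateMap V.fromY).range).comp (coordinateMap V.toX) =
      (coordinateMap f).codRestrict (coordinateMap V.fromY).range V.coordinateMap_mem_range :=
    RingHom.ext fun a => Subtype.ext (RingHom.congr_fun V.coordinateMap_fromY_comp_toX a)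
  constructor
  · intro h
    rw [← he]
    exact h.ringEquiv_comp e
  · intro h
    have h' := h.ringEquiv_comp e.symm
    rw [← he, ← RingHom.comp_assoc] at h'
    rwa [RingEquiv.symm_comp, RingHom.id_comp] at h'

/-- The order on intermediate varieties is the inclusion of coordinate rings in `ℝ[Y]`. -/
theorem le_iff_range_le (hY : IsIrreducibleAffineRealVariety Y)
    (hX : IsIrreducibleAffineRealVariety X) (V W : IntermediateVariety f) :
    V ≤ W ↔ (coordinateMap V.fromY).range ≤ (coordinateMap W.fromY).range := by
  have hW := W.injective_coordinateMap_fromY hY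
  constructor
  · rintro ⟨t, ht, -⟩ _ ⟨v, rfl⟩
    exact ⟨coordinateMap t v, by rw [← ht, coordinateMap_comp]; rfl⟩
  · intro h
    let e := RingEquiv.ofBijective (coordinateMap W.fromY).rangeRestrict
      ⟨fun x y h => hW (congrArg Subtype.val h), (coordinateMap W.fromY).rangeRestrict_surjective⟩
    let g : coordinateRing V.V →+* coordinateRing W.V :=
      (e.symm : _ →+* coordinateRing W.V).comp
        ((Subring.inclusion h).comp (coordinateMap V.fromY).rangeRestrict)
    have hg : (coordinateMap W.fromY).comp g = coordinateMap V.fromY := by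
      ext v
      exact congrArg Subtype.val
        (e.apply_symm_apply (Subring.inclusion h ((coordinateMap V.fromY).rangeRestrict v)))
    have cancel : ∀ {R : Type} [CommRing R] {a b : R →+* coordinateRing W.V},
        (coordinateMap W.fromY).comp a = (coordinateMap W.fromY).comp b → a = b :=
      fun h => RingHom.ext fun x => hW (RingHom.congr_fun h x)
    obtain ⟨t, ht⟩ := exists_coordinateMap_eq (V := W.V) V.isVariety g (cancel (by
      rw [← RingHom.comp_assoc, hg, coordinateMap_comp_realStructure,
        coordinateMap_comp_realStructure]))
    refine ⟨t, eq_of_coordinateMap_eq V.isVariety ?_, eq_of_coordinateMap_eq hX (cancel ?_)⟩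
    · rw [coordinateMap_comp, ht, hg]
    · rw [coordinateMap_comp, ht, ← RingHom.comp_assoc, hg, coordinateMap_fromY_comp_toX,
        coordinateMap_fromY_comp_toX]

/-- Morphisms out of intermediate varieties are determined by their composites with the dominant
morphism from `Y`. -/
theorem fromY_cancel (hY : IsIrreducibleAffineRealVariety Y) (W : IntermediateVariety f)
    {U : Over (Spec (CommRingCat.of ℝ))} (hU : IsIrreducibleAffineRealVariety U) {s t : W.V ⟶ U}
    (h : W.fromY ≫ s = W.fromY ≫ t) : s = t := by
  refine eq_of_coordinateMap_eq hU (RingHom.ext fun x => W.injective_coordinateMap_fromY hY ?_)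
  have := congrArg coordinateMap h
  rw [coordinateMap_comp, coordinateMap_comp] at this
  exact RingHom.congr_fun this x

theorem exists_iso_of_le_of_le (hY : IsIrreducibleAffineRealVariety Y)
    {W Z : IntermediateVariety f} (h : W ≤ Z) (h' : Z ≤ W) :
    ∃ e : W.V ≅ Z.V, W.fromY ≫ e.hom = Z.fromY ∧ e.hom ≫ Z.toX = W.toX := by
  obtain ⟨t, ht, -⟩ := h
  obtain ⟨t', ht', htX'⟩ := h'
  refine ⟨⟨t', t, W.fromY_cancel hY W.isVariety ?_, Z.fromY_cancel hY Z.isVariety ?_⟩, ht', htX'⟩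
  · rw [← Category.assoc, ht', ht, Category.comp_id]
  · rw [← Category.assoc, ht, ht', Category.comp_id]

/-- Every intermediate ring of finite type over `ℝ` comes from an intermediate variety. -/
theorem exists_range_eq (hX : IsIrreducibleAffineRealVariety X)
    (hY : IsIrreducibleAffineRealVariety Y) (D : Subring (coordinateRing Y))
    (hD : ∀ a, coordinateMap f a ∈ D)
    (hft : (((coordinateMap f).codRestrict D hD).comp (realStructure X)).FiniteType) :
    ∃ Z : IntermediateVariety f, (coordinateMap Z.fromY).range = D := by
  have := hY.isDomain
  have := hY.isAffine
  obtain ⟨V, hV, e, he⟩ := exists_isIrreducibleAffineRealVariety hft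
  have := hV.isAffine
  have he' : (e.symm : D →+* coordinateRing V).comp
      (((coordinateMap f).codRestrict D hD).comp (realStructure X)) = realStructure V := by
    rw [← he, ← RingHom.comp_assoc]
    simp
  obtain ⟨s, hs⟩ := exists_coordinateMap_eq (V := Y) hV
    (D.subtype.comp (e : coordinateRing V →+* D)) (by
      rw [RingHom.comp_assoc, he, ← RingHom.comp_assoc]
      exact coordinateMap_comp_realStructure f)
  obtain ⟨t, ht⟩ := exists_coordinateMap_eq (V := V) hX
    ((e.symm : D →+* coordinateRing V).comp ((coordinateMap f).codRestrict D hD))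
    (by rw [RingHom.comp_assoc, he'])
  have hsinj : Function.Injective (coordinateMap s) := by
    rw [hs]; exact Subtype.val_injective.comp e.injective
  refine ⟨⟨V, hV, s, t, eq_of_coordinateMap_eq hX ?_, isDominant_of_of_appTop_injective hsinj⟩, ?_⟩
  · rw [coordinateMap_comp, hs, ht]
    ext a
    simp
  · change (coordinateMap s).range = D
    rw [hs]
    ext b
    constructor
    · rintro ⟨v, rfl⟩
      exact (e v).2
    · intro hb
      exact ⟨e.symm ⟨b, hb⟩, by simp⟩

end IntermediateVariety

/-! ### Existence of the central seminormalization -/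

theorem theorem8p5 (X Y : Over (Spec (CommRingCat.of ℝ)))
    (hX : IsIrreducibleAffineRealVariety X) (hY : IsIrreducibleAffineRealVariety Y)
    (f : Y ⟶ X) (hdom : IsDominant f.left) (hft : (coordinateMap f).FiniteType) :
    ∃ Z : IntermediateVariety f,
      Z.IsCentralSeminormalization ∧
      (∀ V : IntermediateVariety f, V.CentrallySubintegral ↔ V ≤ Z) ∧
      Function.Injective (coordinateMap Z.fromY) ∧
      IsCentralSeminormalizationRing (coordinateMap f) (coordinateMap Z.fromY).range ∧
      ∃ h : ∀ a, coordinateMap f a ∈ (coordinateMap Z.fromY).range,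
        (((coordinateMap f).codRestrict (coordinateMap Z.fromY).range h).comp
          (realStructure X)).FiniteType := by
  have := hX.isDomain
  have := hY.isDomain
  have hinj := coordinateMap_injective_of_isDominant hX hY f hdom
  obtain ⟨D, hD, hDint, hDiff⟩ :=
    exists_subring_isCentrallySubintegral_iff_le (coordinateMap f) hinj
  have hDft := hX.finiteType_realStructure.codRestrict_of_isIntegral hinj hft D hD hDint
  obtain ⟨Z, rfl⟩ := IntermediateVariety.exists_range_eq hX hY D hD hDft
  have key : ∀ V : IntermediateVariety f, V.CentrallySubintegral ↔ V ≤ Z := fun V => by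
    rw [V.centrallySubintegral_iff_range hY, V.le_iff_range_le hY hX, hDiff]
  have hZ : Z.CentrallySubintegral :=
    (key Z).mpr ((Z.le_iff_range_le hY hX Z).mpr le_rfl)
  refine ⟨Z, ⟨⟨hZ, fun V hV _ => (key V).mp hV⟩, fun W hW => ?_⟩, key,
    Z.injective_coordinateMap_fromY hY, ⟨⟨hD, (hDiff _ hD).mpr le_rfl⟩, ?_⟩, hD, hDft⟩
  · have hWZ := (key W).mp hW.prop
    exact IntermediateVariety.exists_iso_of_le_of_le hY hWZ (hW.le_of_ge hZ hWZ)
  · rintro C ⟨h, hC⟩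
    exact (hDiff C h).mp hC
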